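/- Let $I=[0,1]$ and $\partial I=\{0,1\}$, let $Q=\prod_{i=1}^\infty I$ be the Hilbert cube, and let $p_n:Q\to I^n$ be the projection onto the first $n$ factors. A map $g:X\to I^n$ is called essential if it cannot be deformed into $\partial I^n$ through maps of pairs $(X,g^{-1}(\partial I^n))\to(I^n,\partial I^n)$. A map $f:X\to Q$ is called essential if $p_n\circ f$ is essential for every $n$. A compact space $X$ is called strongly infinite dimensional if it admits an essential map onto $Q$. Let $R$ be a ring with unit and let $H^k(X,A)=H^k(X,A;R)$ denote Čech cohomology with coefficients in $R$. A class $\alpha\in H^k(X,A)$ is called pure relative if $j^*(\alpha)=0$, where $j^*:H^k(X,A)\to H^k(X)$ is induced by the inclusion of pairs. **Proposition.** Let $X$ be a compact metric space, let $A_1,A_2,\dots$ be closed subsets of $X$, and let $\alpha_i\in H^1(X,A_i)$, $i=1,2,\dots$, be pure relative classes such that for every $n\ge 1$ the cup product $\alpha_1\cup\alpha_2\cup\dots\cup\alpha_n\in H^n(X,A_1\cup\dots\cup A_n)$ is nonzero. Then $X$ is strongly infinite dimensional. Moreover, let $\phi\in H^1(I,\partial I)$ be the fundamental class, that is, the image under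 the connecting homomorphism of the class in $H^0(\partial I)$ equal to $0$ at the point $0$ and to $1$ at the point $1$. If $f_i:(X,A_i)\to(I,\partial I)$, $i=1,2,\dots$, are maps of pairs with $f_i^*(\phi)=\alpha_i$ for all $i$, then the map $f=(f_1,f_2,\dots):X\to Q$ is essential. -/

import Mathlib

open scoped unitInterval

/-! ## Čech cohomology of a pair `(X, A)` with coefficients in a ring, and its cup product

Čech cohomology is the direct limit, over the open covers of `X`, of the simplicial cohomology of
the pair of nerves.  Every open cover is refined by one of the form `(U x)_{x ∈ X}` with `x ∈ U x`,
and between such covers there is a canonical refinement map (the identity of the index set), so the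
direct limit may be taken on the level of cochains. -/

namespace Cech

/-- An open cover of `X` indexed by the points of `X`, with `x ∈ U x`. -/
structure PointedCover (X : Type*) [TopologicalSpace X] where
  U : X → Set X
  isOpen : ∀ x, IsOpen (U x)
  mem : ∀ x, x ∈ U x

variable {X Y : Type*} [TopologicalSpace X] [TopologicalSpace Y]

/-- The common refinement of two covers. -/
def PointedCover.inf (U V : PointedCover X) : PointedCover X where
  U x := U.U x ∩ V.U x
  isOpen x := (U.isOpen x).inter (V.isOpen x)
  mem x := ⟨U.mem x, V.mem x⟩

/-- The pullback of a cover under a continuous map. -/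
def PointedCover.comap (f : C(X, Y)) (V : PointedCover Y) : PointedCover X where
  U x := f ⁻¹' V.U (f x)
  isOpen x := (V.isOpen (f x)).preimage f.continuous
  mem x := V.mem (f x)

/-- The (ordered) `k`-simplices of the nerve of the cover of `A` by the sets `U x ∩ A`; for
`A = Set.univ` this is the nerve of the cover `U` of `X`. -/
def PointedCover.nerve (U : PointedCover X) (A : Set X) (k : ℕ) : Set (Fin (k + 1) → X) :=
  {s | ∃ z ∈ A, ∀ i, z ∈ U.U (s i)}

variable (R : Type*) [Ring R]

/-- Cochains before passage to the limit: functions on all `(k+1)`-tuples of indices.  Only the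
values on the nerve of a sufficiently fine cover matter. -/
abbrev Cochain (X : Type*) (k : ℕ) : Type _ := (Fin (k + 1) → X) → R

variable {R}

/-- The simplicial coboundary. -/
def d (k : ℕ) : Cochain R X k →+ Cochain R X (k + 1) where
  toFun c := fun s => ∑ i : Fin (k + 2), (-1 : R) ^ (i : ℕ) * c (fun j => s (i.succAbove j))
  map_zero' := by ext s; simp
  map_add' a b := by ext s; simp [mul_add, Finset.sum_add_distrib]

/-- The cochains that vanish on the nerve of `A` for some cover. For `A = Set.univ` these are the
cochains that are zero in the direct limit. -/
def vanishOn (R : Type*) [Ring R] (A : Set X) (k : ℕ) : AddSubgroup (Cochain R X k) where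
  carrier := {c | ∃ U : PointedCover X, ∀ s ∈ U.nerve A k, c s = 0}
  zero_mem' := ⟨⟨fun _ => Set.univ, fun _ => isOpen_univ, fun _ => trivial⟩, fun _ _ => rfl⟩
  add_mem' := by
    rintro a b ⟨U, hU⟩ ⟨V, hV⟩
    refine ⟨U.inf V, fun s ⟨z, hz, h⟩ => ?_⟩
    simp [hU s ⟨z, hz, fun i => (h i).1⟩, hV s ⟨z, hz, fun i => (h i).2⟩]
  neg_mem' := by
    rintro a ⟨U, hU⟩
    exact ⟨U, fun s hs => by simp [hU s hs]⟩

/-- Relative cocycles of `(X, A)`: cochains vanishing on the nerve of `A`, whose coboundary is zero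
in the limit. -/
def cocycles (R : Type*) [Ring R] (A : Set X) (k : ℕ) : AddSubgroup (Cochain R X k) :=
  vanishOn R A k ⊓ (vanishOn R Set.univ (k + 1)).comap (d k)

/-- Relative coboundaries of `(X, A)`: cochains equal in the limit to the coboundary of a cochain
vanishing on the nerve of `A`. -/
def coboundaries (R : Type*) [Ring R] (A : Set X) : (k : ℕ) → AddSubgroup (Cochain R X k)
  | 0 => vanishOn R Set.univ 0
  | k + 1 => (vanishOn R A k).map (d k) ⊔ vanishOn R Set.univ (k + 1)

/-- The Čech cohomology group `H^k(X, A; R)`. -/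
abbrev H (R : Type*) [Ring R] (A : Set X) (k : ℕ) : Type _ :=
  cocycles R A k ⧸ (coboundaries R A k).addSubgroupOf (cocycles R A k)

theorem vanishOn_mono {A B : Set X} (h : A ⊆ B) (k : ℕ) : vanishOn R B k ≤ vanishOn R A k := by
  rintro c ⟨U, hU⟩
  exact ⟨U, fun s ⟨z, hz, hs⟩ => hU s ⟨z, h hz, hs⟩⟩

theorem d_mem_vanishOn {A : Set X} {k : ℕ} {c : Cochain R X k} (hc : c ∈ vanishOn R A k) :
    d k c ∈ vanishOn R A (k + 1) := by
  obtain ⟨U, hU⟩ := hc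
  refine ⟨U, fun s ⟨z, hz, hs⟩ => ?_⟩
  refine (Finset.sum_eq_zero fun i _ => ?_ :
    ∑ i : Fin (k + 2), (-1 : R) ^ (i : ℕ) * c (fun j => s (i.succAbove j)) = 0)
  rw [hU _ ⟨z, hz, fun j => hs _⟩, mul_zero]

/-! ### Induced homomorphisms -/

/-- The pullback of cochains. -/
def cochainPullback (f : X → Y) (k : ℕ) : Cochain R Y k →+ Cochain R X k where
  toFun c := fun s => c (fun i => f (s i))
  map_zero' := rfl
  map_add' _ _ := rfl

theorem cochainPullback_mem {A : Set X} {B : Set Y} (f : C(X, Y)) (hf : Set.MapsTo f A B) {k : ℕ}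
    {c : Cochain R Y k} (hc : c ∈ vanishOn R B k) : cochainPullback f k c ∈ vanishOn R A k := by
  obtain ⟨V, hV⟩ := hc
  exact ⟨V.comap f, fun s ⟨z, hz, hs⟩ => hV _ ⟨f z, hf hz, hs⟩⟩

theorem cochainPullback_mem_cocycles {A : Set X} {B : Set Y} (f : C(X, Y))
    (hf : Set.MapsTo f A B) {k : ℕ} {c : Cochain R Y k} (hc : c ∈ cocycles R B k) :
    cochainPullback f k c ∈ cocycles R A k :=
  ⟨cochainPullback_mem f hf hc.1, cochainPullback_mem f (Set.mapsTo_univ f _) hc.2⟩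

theorem cochainPullback_mem_coboundaries {A : Set X} {B : Set Y} (f : C(X, Y))
    (hf : Set.MapsTo f A B) {k : ℕ} {c : Cochain R Y k} (hc : c ∈ coboundaries R B k) :
    cochainPullback f k c ∈ coboundaries R A k := by
  cases k with
  | zero => exact cochainPullback_mem f (Set.mapsTo_univ f _) hc
  | succ k =>
    obtain ⟨_, ⟨b, hb, rfl⟩, z, hz, rfl⟩ := AddSubgroup.mem_sup.1 hc
    rw [map_add]
    exact AddSubgroup.add_mem_sup ⟨cochainPullback f k b, cochainPullback_mem f hf hb, rfl⟩
      (cochainPullback_mem f (Set.mapsTo_univ f _) hz)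

/-- The homomorphism `f^* : H^k(Y, B) → H^k(X, A)` induced by a map of pairs
`f : (X, A) → (Y, B)`. -/
def pullback {A : Set X} {B : Set Y} (f : C(X, Y)) (hf : Set.MapsTo f A B) (k : ℕ) :
    H R B k →+ H R A k :=
  QuotientAddGroup.map _ _
    (((cochainPullback (R := R) f k).comp (cocycles R B k).subtype).codRestrict (cocycles R A k)
      fun c => cochainPullback_mem_cocycles f hf c.2)
    fun _ hc => cochainPullback_mem_coboundaries f hf hc

/-- `α ∈ H^k(X, A)` is pure relative if `j^* α = 0` in `H^k(X) = H^k(X, ∅)`, where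
`j : (X, ∅) → (X, A)` is the inclusion. -/
def IsPureRelative {A : Set X} {k : ℕ} (α : H R A k) : Prop :=
  pullback (A := ∅) (ContinuousMap.id X) (Set.mapsTo_empty _ _) k α = 0

/-! ### The cup product -/

/-- The cup product of cochains: front face times back face. -/
def cochainCup {k l : ℕ} (a : Cochain R X k) (b : Cochain R X l) : Cochain R X (k + l) :=
  fun s => a (fun i => s (Fin.castLE (by omega) i)) * b (fun i => s (Fin.natAdd k i))

theorem cochainCup_add {X : Type*} {k l : ℕ} (a : Cochain R X k) (b b' : Cochain R X l) :
    cochainCup a (b + b') = cochainCup a b + cochainCup a b' := by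
  ext s; simp [cochainCup, mul_add]

theorem cochainCup_add_left {X : Type*} {k l : ℕ} (a a' : Cochain R X k) (b : Cochain R X l) :
    cochainCup (a + a') b = cochainCup a b + cochainCup a' b := by
  ext s; simp [cochainCup, add_mul]

theorem cochainCup_mem {A B : Set X} {k l : ℕ} {a : Cochain R X k} {b : Cochain R X l}
    (ha : a ∈ vanishOn R A k) (hb : b ∈ vanishOn R B l) :
    cochainCup a b ∈ vanishOn R (A ∪ B) (k + l) := by
  obtain ⟨U, hU⟩ := ha
  obtain ⟨V, hV⟩ := hb
  refine ⟨U.inf V, ?_⟩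
  rintro s ⟨z, hz | hz, hs⟩
  · simp only [cochainCup]; rw [hU _ ⟨z, hz, fun i => (hs _).1⟩, zero_mul]
  · simp only [cochainCup]; rw [hV _ ⟨z, hz, fun i => (hs _).2⟩, mul_zero]

theorem cochainCup_mem_left {A : Set X} {k l : ℕ} {a : Cochain R X k} (b : Cochain R X l)
    (ha : a ∈ vanishOn R A k) : cochainCup a b ∈ vanishOn R A (k + l) := by
  obtain ⟨U, hU⟩ := ha
  refine ⟨U, ?_⟩
  rintro s ⟨z, hz, hs⟩
  simp only [cochainCup]; rw [hU _ ⟨z, hz, fun i => hs _⟩, zero_mul]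

theorem cochainCup_mem_right {A : Set X} {k l : ℕ} (a : Cochain R X k) {b : Cochain R X l}
    (hb : b ∈ vanishOn R A l) : cochainCup a b ∈ vanishOn R A (k + l) := by
  obtain ⟨U, hU⟩ := hb
  refine ⟨U, ?_⟩
  rintro s ⟨z, hz, hs⟩
  simp only [cochainCup]; rw [hU _ ⟨z, hz, fun i => hs _⟩, mul_zero]

/-- Transport of cochains along an equality of degrees. -/
def castDeg {m n : ℕ} (h : m = n) : Cochain R X m →+ Cochain R X n where
  toFun c := fun s => c (fun i => s (Fin.cast (by omega) i))
  map_zero' := rfl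
  map_add' _ _ := rfl

theorem castDeg_mem {m n : ℕ} (h : m = n) {A : Set X} {c : Cochain R X m}
    (hc : c ∈ vanishOn R A m) : castDeg h c ∈ vanishOn R A n := by
  subst h; exact hc

theorem castDeg_mem_coboundaries {m n : ℕ} (h : m = n) {A : Set X} {c : Cochain R X m}
    (hc : c ∈ coboundaries R A m) : castDeg h c ∈ coboundaries R A n := by
  subst h; exact hc

theorem d_eq_range {X : Type*} (k : ℕ) (c : Cochain R X k) (t : ℕ → X) :
    d k c (fun i => t i) = ∑ i ∈ Finset.range (k + 2),
      (-1 : R) ^ i * c (fun j => t (if (j : ℕ) < i then j else j + 1)) := by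
  rw [Finset.sum_range]
  change ∑ i : Fin (k + 2), (-1 : R) ^ (i : ℕ) * c (fun j => t (i.succAbove j : ℕ)) = _
  refine Finset.sum_congr rfl fun i _ => ?_
  congr 2
  ext j
  simp only [Fin.succAbove, Fin.lt_def, Fin.val_castSucc]
  split_ifs <;> simp

/-- The Leibniz rule `d (a ∪ b) = d a ∪ b + (-1)^k a ∪ d b`. -/
theorem d_cochainCup {X : Type*} {k l : ℕ} (a : Cochain R X k) (b : Cochain R X l) :
    d (k + l) (cochainCup a b) =
      castDeg (by omega) (cochainCup (d k a) b) + (-1 : ℤ) ^ k • cochainCup a (d l b) := by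
  ext s
  obtain ⟨t, rfl⟩ : ∃ t : ℕ → X, s = fun i : Fin (k + l + 1 + 1) => t i :=
    ⟨fun n => if h : n < k + l + 1 + 1 then s ⟨n, h⟩ else s 0, by
      ext i; simp only [i.2, dite_true]⟩
  rw [d_eq_range]
  have h1 : castDeg (show k + 1 + l = k + l + 1 by omega) (cochainCup (d k a) b) (fun i => t i) =
      d k a (fun i => t i) * b (fun i => t (k + 1 + i)) := rfl
  rw [Pi.add_apply, Pi.smul_apply, h1]
  change _ = _ + (-1 : ℤ) ^ k • (a (fun i => t i) * d l b (fun i => (fun n => t (k + n)) i))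
  rw [d_eq_range k, d_eq_range l b (fun n => t (k + n)), Finset.sum_range_succ (n := k + 1), Finset.sum_range_succ' (n := l + 1),
    show k + l + 2 = (k + 1) + (l + 1) by omega, Finset.sum_range_add]
  have e1 : ∀ i ∈ Finset.range (k + 1), (-1 : R) ^ i *
      cochainCup a b (fun j => t (if (j : ℕ) < i then j else j + 1)) =
      (-1 : R) ^ i * a (fun j => t (if (j : ℕ) < i then j else j + 1)) *
        b (fun j => t (k + 1 + j)) := by
    intro i hi
    have hi := Finset.mem_range.1 hi
    rw [mul_assoc]
    simp only [cochainCup, Fin.val_castLE, Fin.val_natAdd]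
    congr 3
    ext j
    rw [if_neg (by omega)]
    congr 1
    omega
  have e2 : ∀ i ∈ Finset.range (l + 1), (-1 : R) ^ (k + 1 + i) *
      cochainCup a b (fun j => t (if (j : ℕ) < k + 1 + i then j else j + 1)) =
      (-1 : R) ^ k * (a (fun j => t j) * ((-1 : R) ^ (i + 1) *
        b (fun j => t (k + if (j : ℕ) < i + 1 then (j : ℕ) else (j : ℕ) + 1)))) := by
    intro i hi
    have hc : (-1 : R) ^ (i + 1) * a (fun j => t j) = a (fun j => t j) * (-1 : R) ^ (i + 1) :=
      ((Commute.neg_one_left _).pow_left _).eq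
    rw [← mul_assoc (a _), ← hc, mul_assoc ((-1 : R) ^ (i + 1)), ← mul_assoc, ← pow_add,
      show k + (i + 1) = k + 1 + i by omega]
    simp only [cochainCup, Fin.val_castLE, Fin.val_natAdd]
    congr 3
    · ext j
      rw [if_pos (by omega)]
    · ext j
      congr 1
      split_ifs <;> omega
  rw [Finset.sum_congr rfl e1, Finset.sum_congr rfl e2, ← Finset.sum_mul, ← Finset.mul_sum,
    ← Finset.mul_sum]
  have e3 : (fun j : Fin (k + 1) => t (if (j : ℕ) < k + 1 then j else j + 1)) = fun j : Fin (k + 1) => t j := by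
    ext j; rw [if_pos (by omega)]
  have e4 : (fun j : Fin (l + 1) => t (k + if (j : ℕ) < 0 then (j : ℕ) else (j : ℕ) + 1)) =
      fun j : Fin (l + 1) => t (k + 1 + j) := by
    ext j; rw [if_neg (by omega)]; congr 1; omega
  have e5 : ∀ x : R, ((-1 : ℤ) ^ k • x) = (-1 : R) ^ k * x := by
    intro x; simp [zsmul_eq_mul]
  rw [e3, e4, e5, pow_succ]
  noncomm_ring

theorem zsmul_mem_vanishOn {A : Set X} {k : ℕ} {c : Cochain R X k} (n : ℤ)
    (hc : c ∈ vanishOn R A k) : n • c ∈ vanishOn R A k := AddSubgroup.zsmul_mem _ hc n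

theorem cochainCup_mem_cocycles {A B : Set X} {k l : ℕ} {a : Cochain R X k} {b : Cochain R X l}
    (ha : a ∈ cocycles R A k) (hb : b ∈ cocycles R B l) :
    cochainCup a b ∈ cocycles R (A ∪ B) (k + l) := by
  refine ⟨cochainCup_mem ha.1 hb.1, ?_⟩
  change d (k + l) (cochainCup a b) ∈ vanishOn R Set.univ (k + l + 1)
  rw [d_cochainCup]
  exact add_mem (castDeg_mem (show k + 1 + l = k + l + 1 by omega) (cochainCup_mem_left b ha.2))
    (zsmul_mem_vanishOn _ (cochainCup_mem_right a hb.2))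

theorem vanishOn_univ_le_coboundaries (A : Set X) (k : ℕ) :
    vanishOn R Set.univ k ≤ coboundaries R A k := by
  cases k with
  | zero => exact le_rfl
  | succ k => exact le_sup_right

theorem cochainCup_mem_coboundaries_left {A B : Set X} {k l : ℕ} {a : Cochain R X k}
    {b : Cochain R X l} (ha : a ∈ coboundaries R A k) (hb : b ∈ cocycles R B l) :
    cochainCup a b ∈ coboundaries R (A ∪ B) (k + l) := by
  cases k with
  | zero => exact vanishOn_univ_le_coboundaries _ _ (cochainCup_mem_left b ha)
  | succ k =>
    obtain ⟨_, ⟨e, he, rfl⟩, z, hz, rfl⟩ := AddSubgroup.mem_sup.1 ha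
    rw [cochainCup_add_left]
    refine add_mem ?_ (vanishOn_univ_le_coboundaries _ _ (cochainCup_mem_left b hz))
    have key : cochainCup (d k e) b = castDeg (show k + l + 1 = k + 1 + l by omega)
        (d (k + l) (cochainCup e b) - (-1 : ℤ) ^ k • cochainCup e (d l b)) := by
      rw [d_cochainCup, add_sub_cancel_right]; rfl
    rw [key]
    refine castDeg_mem_coboundaries (by omega) (sub_mem ?_ ?_)
    · exact AddSubgroup.mem_sup_left ⟨_, cochainCup_mem he hb.1, rfl⟩
    · exact AddSubgroup.mem_sup_right (zsmul_mem_vanishOn _ (cochainCup_mem_right e hb.2))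

theorem cochainCup_mem_coboundaries_right {A B : Set X} {k l : ℕ} {a : Cochain R X k}
    {b : Cochain R X l} (ha : a ∈ cocycles R A k) (hb : b ∈ coboundaries R B l) :
    cochainCup a b ∈ coboundaries R (A ∪ B) (k + l) := by
  cases l with
  | zero => exact vanishOn_univ_le_coboundaries _ _ (cochainCup_mem_right a hb)
  | succ l =>
    obtain ⟨_, ⟨e, he, rfl⟩, z, hz, rfl⟩ := AddSubgroup.mem_sup.1 hb
    rw [cochainCup_add]
    refine add_mem ?_ (vanishOn_univ_le_coboundaries _ _ (cochainCup_mem_right a hz))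
    have key : cochainCup a (d l e) = (-1 : ℤ) ^ k • (d (k + l) (cochainCup a e) -
        castDeg (by omega) (cochainCup (d k a) e)) := by
      rw [d_cochainCup, add_sub_cancel_left, smul_smul, ← mul_pow]; simp
    rw [key]
    refine AddSubgroup.zsmul_mem _ (sub_mem ?_ ?_) _
    · exact AddSubgroup.mem_sup_left ⟨_, cochainCup_mem ha.1 he, rfl⟩
    · exact AddSubgroup.mem_sup_right (castDeg_mem (show k + 1 + l = k + l + 1 by omega) (cochainCup_mem_left e ha.2))

/-- The cup product `H^k(X, A) × H^l(X, B) → H^{k+l}(X, A ∪ B)`. -/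
def cup {A B : Set X} {k l : ℕ} : H R A k →+ H R B l →+ H R (A ∪ B) (k + l) :=
  QuotientAddGroup.lift _
    (AddMonoidHom.mk' (fun a => QuotientAddGroup.map _ _
      (AddMonoidHom.mk' (fun b => (⟨cochainCup a.1 b.1, cochainCup_mem_cocycles a.2 b.2⟩ :
          cocycles R (A ∪ B) (k + l)))
        fun b b' => Subtype.ext (cochainCup_add a.1 b.1 b'.1))
      fun _ hb => cochainCup_mem_coboundaries_right a.2 hb)
      fun a a' => by
        ext b
        exact congrArg (QuotientAddGroup.mk (s := (coboundaries R (A ∪ B) (k + l)).addSubgroupOf _))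
          (Subtype.ext (cochainCup_add_left a.1 a'.1 b.1)))
    fun a ha => by
      ext b
      exact (QuotientAddGroup.eq_zero_iff _).2 (cochainCup_mem_coboundaries_left ha b.2)

/-- `A 0 ∪ ⋯ ∪ A n`. -/
def unionUpTo (A : ℕ → Set X) : ℕ → Set X
  | 0 => A 0
  | n + 1 => unionUpTo A n ∪ A (n + 1)

/-- The product `α 0 ∪ ⋯ ∪ α n` of `n + 1` classes of degree one. -/
def cupProd {A : ℕ → Set X} (α : ∀ i, H R (A i) 1) : (n : ℕ) → H R (unionUpTo A n) (n + 1)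
  | 0 => α 0
  | n + 1 => cup (cupProd α n) (α (n + 1))

/-! ### The fundamental class of the interval -/

open Classical in
/-- The `0`-cochain on `I` that is `1` at the point `1` and `0` elsewhere. -/
noncomputable def endCochain (R : Type*) [Ring R] : Cochain R I 0 :=
  fun s => if s 0 = 1 then 1 else 0

theorem d_endCochain_mem : d 0 (endCochain R) ∈ cocycles R ({0, 1} : Set I) 1 := by
  classical
  constructor
  · refine ⟨⟨fun x => if x = 1 then {0}ᶜ else {1}ᶜ, fun x => ?_, fun x => ?_⟩, ?_⟩
    · split_ifs <;> exact isOpen_compl_singleton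
    · by_cases h : x = 1 <;> simp [h]
    · rintro s ⟨z, hz, hs⟩
      have h0 := hs 0
      have h1 := hs 1
      rcases hz with rfl | rfl
      · have a0 : s 0 ≠ 1 := fun h => by simp [h] at h0
        have a1 : s 1 ≠ 1 := fun h => by simp [h] at h1
        simp [d, endCochain, Fin.sum_univ_two, a0, a1]
      · have a0 : s 0 = 1 := by by_contra h; simp [h] at h0
        have a1 : s 1 = 1 := by by_contra h; simp [h] at h1
        simp [d, endCochain, Fin.sum_univ_two, a0, a1]
  · have : d 1 (d 0 (endCochain R)) = 0 := by
      ext s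
      obtain ⟨t, rfl⟩ : ∃ t : ℕ → I, s = fun i : Fin 3 => t i :=
        ⟨fun n => if h : n < 3 then s ⟨n, h⟩ else s 0, by
          ext i; simp only [i.2, dite_true]⟩
      rw [d_eq_range]
      simp [d, Fin.sum_univ_two, Finset.sum_range_succ, endCochain]
      abel
    change d 1 (d 0 (endCochain R)) ∈ vanishOn R Set.univ 2
    rw [this]
    exact zero_mem _

/-- The fundamental class `φ ∈ H^1(I, ∂I; R)`: the image under the connecting homomorphism of the
class in `H^0(∂I; R)` that is `0` at the point `0` and `1` at the point `1`. -/
noncomputable def fundamentalClass (R : Type*) [Ring R] : H R ({0, 1} : Set I) 1 :=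
  QuotientAddGroup.mk ⟨d 0 (endCochain R), d_endCochain_mem⟩

end Cech

/-! ## Essential maps and strong infinite dimensionality -/

/-- A map `f : X → I^n` is essential if it cannot be deformed into `∂I^n` through maps of pairs
`(X, f⁻¹(∂I^n)) → (I^n, ∂I^n)`. -/
def IsEssential {X : Type*} [TopologicalSpace X] {n : ℕ} (f : C(X, Fin n → I)) : Prop :=
  ¬ ∃ g : C(X, Fin n → I), (∀ x, g x ∈ Cube.boundary (Fin n)) ∧
    f.HomotopicWith g
      (fun h => Set.MapsTo h (f ⁻¹' Cube.boundary (Fin n)) (Cube.boundary (Fin n)))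

/-- The projection `p_n : Q → I^n` of the Hilbert cube `Q = I^ℕ` onto the first `n` factors. -/
def hilbertCubeProj (n : ℕ) : C(ℕ → I, Fin n → I) where
  toFun q := fun i => q i
  continuous_toFun := by fun_prop

/-- A map to the Hilbert cube is essential if all its compositions with the `p_n` are. -/
def IsEssentialHilbert {X : Type*} [TopologicalSpace X] (f : C(X, ℕ → I)) : Prop :=
  ∀ n, IsEssential ((hilbertCubeProj n).comp f)

/-- A (compact) space is strongly infinite dimensional if it admits an essential map onto the
Hilbert cube. -/
def StronglyInfiniteDimensional (X : Type*) [TopologicalSpace X] : Prop :=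
  ∃ f : C(X, ℕ → I), Function.Surjective f ∧ IsEssentialHilbert f

/-!
The cohomology is worked out on cochains. The class `f^* φ ∈ H^1(X, A)` is represented by the
coboundary of `e ∘ f`, so it depends only on `f` on the closed set `A`, and its representative
vanishes on the nerve of the whole set `f⁻¹ {0, 1}`. Hence if `(f 0, …, f n)` takes values in the
boundary of the cube, the product of the `f i ^* φ` is represented by a cochain that vanishes
on `X`, and it is zero (`cupProd_pullback_eq_zero`).

Suppose now that these products are nonzero for all `n`. If `(f 0, …, f n)` omitted a point, one
could stretch a box around it to push the map into the boundary without changing it on the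
`A i`, a contradiction (`exists_eq_of_cupProd_ne_zero`). By compactness `(f 0, f 1, …)` is onto
the Hilbert cube. If a finite part of it could be deformed into the boundary, stopping the
deformation early near the preimage of the boundary would give a map that agrees with it on
the `A i` and omits the centre of the cube, again a contradiction
(`isEssentialHilbert_of_cupProd_ne_zero`).

It remains to find such `f i` when only pure relative classes are given. Each is a finite sum of
classes `r • f^* φ` (`IsPureRelative.exists_eq_sum`). Expanding the products shows that for each `n`
some product of `n + 1` of the classes `f^* φ` is nonzero, and König's lemma gives one sequence of
choices that works for all `n`.
-/

namespace Cech

variable {X : Type*} [TopologicalSpace X] {R : Type*} [Ring R]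

/-! ### Cup products of cochains of degree one -/

/-- The cochain product `c 0 ∪ ⋯ ∪ c n`, representing `cupProd` of the classes of the `c i`. -/
def cochainProd (c : ℕ → Cochain R X 1) : (n : ℕ) → Cochain R X (n + 1)
  | 0 => c 0
  | n + 1 => cochainCup (cochainProd c n) (c (n + 1))

theorem cochainProd_mem_cocycles {A : ℕ → Set X} {c : ℕ → Cochain R X 1}
    (hc : ∀ i, c i ∈ cocycles R (A i) 1) (n : ℕ) :
    cochainProd c n ∈ cocycles R (unionUpTo A n) (n + 1) := by
  induction n with
  | zero => exact hc 0
  | succ n ih => exact cochainCup_mem_cocycles ih (hc (n + 1))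

theorem cochainProd_mem_vanishOn {A : ℕ → Set X} {c : ℕ → Cochain R X 1}
    (hc : ∀ i, c i ∈ vanishOn R (A i) 1) (n : ℕ) :
    cochainProd c n ∈ vanishOn R (unionUpTo A n) (n + 1) := by
  induction n with
  | zero => exact hc 0
  | succ n ih => exact cochainCup_mem ih (hc (n + 1))

theorem cupProd_mk {A : ℕ → Set X} {c : ℕ → Cochain R X 1}
    (hc : ∀ i, c i ∈ cocycles R (A i) 1) (n : ℕ) :
    cupProd (A := A) (fun i => QuotientAddGroup.mk ⟨c i, hc i⟩) n =
      QuotientAddGroup.mk ⟨cochainProd c n, cochainProd_mem_cocycles hc n⟩ := by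
  induction n with
  | zero => rfl
  | succ n ih => rw [cupProd, ih]; rfl

theorem mk_eq_zero_iff {A : Set X} {k : ℕ} {c : Cochain R X k} (hc : c ∈ cocycles R A k) :
    (QuotientAddGroup.mk ⟨c, hc⟩ : H R A k) = 0 ↔ c ∈ coboundaries R A k :=
  QuotientAddGroup.eq_zero_iff _

theorem mk_eq_mk_iff {A : Set X} {k : ℕ} {c c' : Cochain R X k} (hc : c ∈ cocycles R A k)
    (hc' : c' ∈ cocycles R A k) :
    (QuotientAddGroup.mk ⟨c, hc⟩ : H R A k) = QuotientAddGroup.mk ⟨c', hc'⟩ ↔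
      c - c' ∈ coboundaries R A k := by
  rw [QuotientAddGroup.eq_iff_sub_mem]; rfl

theorem mem_unionUpTo {X : Type*} {A : ℕ → Set X} {n : ℕ} {x : X} :
    x ∈ unionUpTo A n ↔ ∃ i ≤ n, x ∈ A i := by
  induction n with
  | zero => simp [unionUpTo]
  | succ n ih =>
    simp only [unionUpTo, Set.mem_union, ih, Nat.le_succ_iff, or_and_right, exists_or,
      exists_eq_left]

/-- In degree zero, a cochain that is zero at the points of a closed set `A` vanishes on the nerve
of `A`: give the points outside `A` a neighbourhood missing `A`. -/
theorem mem_vanishOn_zero {A : Set X} (hA : IsClosed A) {c : Cochain R X 0}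
    (hc : ∀ s, s 0 ∈ A → c s = 0) : c ∈ vanishOn R A 0 := by
  refine ⟨⟨fun x => {z | z ∈ A → x ∈ A}, fun x => ?_, fun x hx => hx⟩, ?_⟩
  · by_cases hx : x ∈ A
    · simp [hx]
    · simp only [hx, imp_false]
      exact hA.isOpen_compl
  · rintro s ⟨z, hz, hs⟩
    exact hc s (hs 0 hz)

theorem d_mem_coboundaries {A : Set X} {k : ℕ} {c : Cochain R X k} (hc : c ∈ vanishOn R A k) :
    d k c ∈ coboundaries R A (k + 1) :=
  AddSubgroup.mem_sup_left ⟨c, hc, rfl⟩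

theorem d_zero_apply {Y : Type*} (c : Cochain R Y 0) (s : Fin 2 → Y) :
    d 0 c s = c (fun _ => s 1) - c (fun _ => s 0) := by
  have h : ∀ (t : Fin 1 → Y), t = fun _ => t 0 := fun t => funext fun i => by
    rw [Subsingleton.elim i 0]
  simp only [d, AddMonoidHom.coe_mk, ZeroHom.coe_mk]
  rw [Fin.sum_univ_two, h fun j => s (Fin.succAbove 0 j), h fun j => s (Fin.succAbove 1 j)]
  simp [sub_eq_add_neg]

/-! ### Classes pulled back from the interval -/

/-- The cocycle `f^* (d e)` representing `f^* φ`, where `e` is `endCochain R`. -/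
noncomputable def pullbackFundamental (R : Type*) [Ring R] (f : C(X, I)) : Cochain R X 1 :=
  cochainPullback f 1 (d 0 (endCochain R))

theorem pullbackFundamental_mem_cocycles {A : Set X} {f : C(X, I)} (hf : Set.MapsTo f A {0, 1}) :
    pullbackFundamental R f ∈ cocycles R A 1 :=
  cochainPullback_mem_cocycles f hf d_endCochain_mem

theorem pullback_fundamentalClass {A : Set X} {f : C(X, I)} (hf : Set.MapsTo f A {0, 1}) :
    pullback f hf 1 (fundamentalClass R) =
      QuotientAddGroup.mk ⟨pullbackFundamental R f, pullbackFundamental_mem_cocycles hf⟩ :=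
  rfl

theorem pullbackFundamental_eq (f : C(X, I)) :
    pullbackFundamental R f = d 0 (cochainPullback f 0 (endCochain R)) :=
  rfl

/-- `f^* φ ∈ H^1(X, A)` depends only on the restriction of `f` to the closed set `A`. -/
theorem pullback_fundamentalClass_congr {A : Set X} (hA : IsClosed A) {f g : C(X, I)}
    (hf : Set.MapsTo f A {0, 1}) (hg : Set.MapsTo g A {0, 1}) (h : Set.EqOn f g A) :
    pullback f hf 1 (fundamentalClass R) = pullback g hg 1 (fundamentalClass R) := by
  rw [pullback_fundamentalClass, pullback_fundamentalClass, mk_eq_mk_iff, pullbackFundamental_eq,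
    pullbackFundamental_eq, ← map_sub]
  refine d_mem_coboundaries (mem_vanishOn_zero hA fun s hs => ?_)
  simp [cochainPullback, endCochain, h hs]

/-- If `(f 0, …, f n)` takes values in the boundary of the cube, then the sets `f i ⁻¹ {0, 1}`
cover `X`, so the product of the cocycles representing `f i ^* φ` is zero in the limit. -/
theorem cupProd_pullback_eq_zero {A : ℕ → Set X} {f : ℕ → C(X, I)}
    (hf : ∀ i, Set.MapsTo (f i) (A i) {0, 1}) {n : ℕ}
    (h : ∀ x, ∃ i ≤ n, f i x ∈ ({0, 1} : Set I)) :
    cupProd (fun i => pullback (f i) (hf i) 1 (fundamentalClass R)) n = 0 := by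
  refine (cupProd_mk (fun i => pullbackFundamental_mem_cocycles (hf i)) n).trans ?_
  rw [mk_eq_zero_iff]
  refine vanishOn_univ_le_coboundaries _ _ ?_
  have hU : unionUpTo (fun i => f i ⁻¹' {0, 1}) n = Set.univ :=
    Set.eq_univ_of_forall fun x => mem_unionUpTo.2 (h x)
  rw [← hU]
  exact cochainProd_mem_vanishOn
    (fun i => (pullbackFundamental_mem_cocycles (Set.mapsTo_preimage (f i) _)).1) n

/-! ### Nonzero products force surjectivity and essentiality -/

/-- The piecewise linear map `I → I` sending everything up to `a` to `0` and everything from `b` on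
to `1`. -/
noncomputable def stretch (a b : ℝ) : C(I, I) where
  toFun t := Set.projIcc 0 1 zero_le_one ((t - a) / (b - a))
  continuous_toFun := continuous_projIcc.comp (by fun_prop)

theorem stretch_of_le {a b : ℝ} (hab : a < b) {t : I} (h : t ≤ a) : stretch a b t = 0 :=
  Set.projIcc_of_le_left zero_le_one (div_nonpos_of_nonpos_of_nonneg (by linarith) (by linarith))

theorem stretch_of_ge {a b : ℝ} (hab : a < b) {t : I} (h : b ≤ t) : stretch a b t = 1 :=
  Set.projIcc_of_right_le zero_le_one ((one_le_div (by linarith)).2 (by linarith))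

/-- If the product of the `f i ^* φ` is nonzero, then `(f 0, …, f n)` attains every value `q`.
Otherwise its compact image misses a box around `q`, and stretching that box over the whole cube
moves the image to the boundary without changing the classes. -/
theorem exists_eq_of_cupProd_ne_zero [CompactSpace X] {A : ℕ → Set X} (hA : ∀ i, IsClosed (A i))
    {f : ℕ → C(X, I)} (hf : ∀ i, Set.MapsTo (f i) (A i) {0, 1}) {n : ℕ}
    (h : cupProd (fun i => pullback (f i) (hf i) 1 (fundamentalClass R)) n ≠ 0) (q : ℕ → I) :
    ∃ x, ∀ i ≤ n, f i x = q i := by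
  by_contra! hq
  let F : X → Fin (n + 1) → I := fun x i => f i x
  have hF : IsClosed (Set.range F) :=
    (isCompact_range (by fun_prop : Continuous F)).isClosed
  have hqF : (fun i : Fin (n + 1) => q i) ∉ Set.range F := by
    rintro ⟨x, hx⟩
    obtain ⟨i, hi, hne⟩ := hq x
    exact hne (congrFun hx ⟨i, Nat.lt_succ_of_le hi⟩)
  obtain ⟨ε, hε, hball⟩ := Metric.isOpen_iff.1 hF.isOpen_compl _ hqF
  have hdist : ∀ x, ∃ i ≤ n, ε ≤ dist (f i x) (q i) := by
    intro x
    by_contra! hx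
    refine hball (Metric.mem_ball.2 ((dist_pi_lt_iff hε).2 fun i => ?_)) ⟨x, rfl⟩
    exact hx i (Nat.le_of_lt_succ i.2)
  let a : ℕ → ℝ := fun i => max (q i - ε) 0
  let b : ℕ → ℝ := fun i => min (q i + ε) 1
  -- `a i < b i` because `0 ≤ q i ≤ 1`, even where `q i` is an end point.
  have hab : ∀ i, a i < b i := fun i => by
    have h0 := (q i).2.1
    have h1 := (q i).2.2
    exact max_lt (lt_min (by linarith) (by linarith)) (lt_min (by linarith) one_pos)
  have h0 : ∀ i, stretch (a i) (b i) 0 = 0 := fun i => stretch_of_le (hab i) (le_max_right _ _)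
  have h1 : ∀ i, stretch (a i) (b i) 1 = 1 := fun i => stretch_of_ge (hab i) (min_le_right _ _)
  let g : ℕ → C(X, I) := fun i => (stretch (a i) (b i)).comp (f i)
  have hfg : ∀ i, Set.EqOn (f i) (g i) (A i) := by
    intro i x hx
    rcases hf i hx with e | e
    · simp [g, e, h0]
    · simp [g, Set.mem_singleton_iff.1 e, h1]
  have hg : ∀ i, Set.MapsTo (g i) (A i) {0, 1} := fun i => (hf i).congr (hfg i)
  refine h ?_
  rw [funext fun i => pullback_fundamentalClass_congr (R := R) (hA i) (hf i) (hg i) (hfg i)]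
  refine cupProd_pullback_eq_zero hg fun x => ?_
  obtain ⟨i, hi, hd⟩ := hdist x
  refine ⟨i, hi, ?_⟩
  rw [Subtype.dist_eq, Real.dist_eq, le_abs'] at hd
  rcases hd with hd | hd
  · exact Or.inl (stretch_of_le (hab i) (le_max_of_le_left (by linarith)))
  · exact Or.inr (stretch_of_ge (hab i) (min_le_of_left_le (by linarith)))

/-- Urysohn's lemma with values in `I`. -/
theorem exists_unitInterval_map [NormalSpace X] {s t : Set X} (hs : IsClosed s) (ht : IsClosed t)
    (hd : Disjoint s t) : ∃ f : C(X, I), (∀ x ∈ s, f x = 0) ∧ ∀ x ∈ t, f x = 1 := by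
  obtain ⟨f, h0, h1, h⟩ := exists_continuous_zero_one_of_isClosed hs ht hd
  exact ⟨⟨fun x => ⟨f x, h x⟩, by fun_prop⟩, fun x hx => Subtype.ext (h0 hx),
    fun x hx => Subtype.ext (h1 hx)⟩

/-- Maps whose classes `f i ^* φ` have nonzero products form an essential map to the Hilbert cube.
A deformation `h` of `(f 0, …, f (n - 1))` into the boundary, run only for the time `l x` at `x`,
gives a map that avoids the centre of the cube and agrees with the original one on the preimage of
the boundary; it cannot exist by `exists_eq_of_cupProd_ne_zero`. -/
theorem isEssentialHilbert_of_cupProd_ne_zero [CompactSpace X] [NormalSpace X]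
    {A : ℕ → Set X} (hA : ∀ i, IsClosed (A i))
    {f : ℕ → C(X, I)} (hf : ∀ i, Set.MapsTo (f i) (A i) {0, 1})
    (hne : ∀ n, cupProd (fun i => pullback (f i) (hf i) 1 (fundamentalClass R)) n ≠ 0) :
    IsEssentialHilbert (ContinuousMap.pi f) := by
  rintro n ⟨g, hg, ⟨h⟩⟩
  set F : C(X, Fin n → I) := (hilbertCubeProj n).comp (ContinuousMap.pi f)
  let half : I := ⟨1 / 2, by norm_num, by norm_num⟩
  have hbd : ∀ y ∈ Cube.boundary (Fin n), y ≠ fun _ => half := by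
    rintro y ⟨i, hi⟩ rfl
    rcases hi with hi | hi <;>
      · have := congrArg Subtype.val hi
        norm_num [half] at this
  have hclosed : IsClosed (Cube.boundary (Fin n)) := by
    have : Cube.boundary (Fin n) = ⋃ i, (fun y : Fin n → I => y i) ⁻¹' {0, 1} := by
      ext y; simp [Cube.boundary]
    rw [this]
    exact isClosed_iUnion_of_finite fun i =>
      (Set.toFinite ({0, 1} : Set I)).isClosed.preimage (continuous_apply i)
  -- The points whose track under the deformation meets the centre.
  let V : Set X := Prod.snd '' ((fun p : I × X => h p) ⁻¹' {fun _ => half})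
  have hV : IsClosed V :=
    isClosedMap_snd_of_compactSpace _ (isClosed_singleton.preimage (by fun_prop))
  have hdisj : Disjoint (F ⁻¹' Cube.boundary (Fin n)) V := by
    rw [Set.disjoint_left]
    rintro _ hx ⟨⟨t, x⟩, htx, rfl⟩
    exact hbd _ (h.prop' t hx) htx
  obtain ⟨l, hl0, hl1⟩ := exists_unitInterval_map (hclosed.preimage F.continuous) hV hdisj
  have hcentre : ∀ x, h (l x, x) ≠ fun _ => half := by
    intro x hx
    have hl : l x = 1 := hl1 x ⟨(l x, x), hx, rfl⟩
    rw [hl, h.apply_one] at hx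
    exact hbd _ (hg x) hx
  let G : ℕ → C(X, I) := fun i =>
    if hi : i < n then ⟨fun x => h (l x, x) ⟨i, hi⟩, by fun_prop⟩ else f i
  have hfG : ∀ i, Set.EqOn (f i) (G i) (A i) := by
    intro i x hx
    by_cases hi : i < n
    · have hl : l x = 0 := hl0 x ⟨⟨i, hi⟩, hf i hx⟩
      simp only [G, hi, dite_true, ContinuousMap.coe_mk, hl]
      rw [h.apply_zero]
      rfl
    · simp only [G, hi, dite_false]
  have hG : ∀ i, Set.MapsTo (G i) (A i) {0, 1} := fun i => (hf i).congr (hfG i)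
  have hGn := hne n
  rw [funext fun i => pullback_fundamentalClass_congr (R := R) (hA i) (hf i) (hG i) (hfG i)] at hGn
  obtain ⟨x, hx⟩ := exists_eq_of_cupProd_ne_zero hA hG hGn fun _ => half
  refine hcentre x (funext fun i => ?_)
  have := hx i i.2.le
  simpa only [G, i.2, dite_true, ContinuousMap.coe_mk, Fin.eta] using this

/-- Coordinates whose classes have nonzero products define a map onto the Hilbert cube. -/
theorem surjective_pi_of_cupProd_ne_zero [CompactSpace X]
    {A : ℕ → Set X} (hA : ∀ i, IsClosed (A i))
    {f : ℕ → C(X, I)} (hf : ∀ i, Set.MapsTo (f i) (A i) {0, 1})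
    (hne : ∀ n, cupProd (fun i => pullback (f i) (hf i) 1 (fundamentalClass R)) n ≠ 0) :
    Function.Surjective (ContinuousMap.pi f) := by
  intro q
  have hcl : ∀ n, IsClosed {x | ∀ i ≤ n, f i x = q i} := fun n => by
    simp only [Set.ofPred_forall]
    exact isClosed_iInter fun i => isClosed_iInter fun _ =>
      isClosed_eq (f i).continuous continuous_const
  obtain ⟨x, hx⟩ := IsCompact.nonempty_iInter_of_sequence_nonempty_isCompact_isClosed
    (fun n => {x | ∀ i ≤ n, f i x = q i}) (fun n x hx i hi => hx i (hi.trans n.le_succ))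
    (fun n => exists_eq_of_cupProd_ne_zero hA hf (hne n) q) (hcl 0).isCompact hcl
  exact ⟨x, funext fun i => Set.mem_iInter.1 hx i i le_rfl⟩

/-! ### Pure relative classes of degree one -/

theorem d_smul {Y : Type*} {k : ℕ} (r : R) (c : Cochain R Y k) : d k (r • c) = r • d k c := by
  ext s
  simp only [d, AddMonoidHom.coe_mk, ZeroHom.coe_mk, Pi.smul_apply, smul_eq_mul, Finset.mul_sum]
  refine Finset.sum_congr rfl fun i _ => ?_
  rw [← mul_assoc, ← mul_assoc, ((Commute.neg_one_left r).pow_left _).eq]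

theorem smul_mem_vanishOn {A : Set X} {k : ℕ} (r : R) {c : Cochain R X k}
    (hc : c ∈ vanishOn R A k) : r • c ∈ vanishOn R A k := by
  obtain ⟨U, hU⟩ := hc
  exact ⟨U, fun s hs => by simp [hU s hs]⟩

theorem smul_mem_cocycles {A : Set X} {k : ℕ} (r : R) {c : Cochain R X k}
    (hc : c ∈ cocycles R A k) : r • c ∈ cocycles R A k := by
  refine ⟨smul_mem_vanishOn r hc.1, ?_⟩
  change d k (r • c) ∈ vanishOn R Set.univ (k + 1)
  rw [d_smul]
  exact smul_mem_vanishOn r hc.2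

theorem smul_mem_coboundaries {A : Set X} {k : ℕ} (r : R) {c : Cochain R X k}
    (hc : c ∈ coboundaries R A k) : r • c ∈ coboundaries R A k := by
  cases k with
  | zero => exact smul_mem_vanishOn r hc
  | succ k =>
    obtain ⟨_, ⟨b, hb, rfl⟩, z, hz, rfl⟩ := AddSubgroup.mem_sup.1 hc
    rw [smul_add, ← d_smul]
    exact add_mem (d_mem_coboundaries (smul_mem_vanishOn r hb))
      (vanishOn_univ_le_coboundaries _ _ (smul_mem_vanishOn r hz))

/-- A pure relative class in `H^1(X, A)` is a finite linear combination of classes `g r ^* φ`. It is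
the image under the connecting homomorphism of a locally constant function `A → R`, which has
finitely many values `r` by compactness; `g r` is a Urysohn function equal to `1` where the value
is `r` and to `0` on the rest of `A`. -/
theorem IsPureRelative.exists_eq_sum [CompactSpace X] [NormalSpace X] {A : Set X}
    (hA : IsClosed A) {α : H R A 1} (hα : IsPureRelative α) :
    ∃ (S : Finset R) (g : R → C(X, I)), (∀ r, Set.MapsTo (g r) A {0, 1}) ∧
      ∃ hc : ∑ r ∈ S, r • pullbackFundamental R (g r) ∈ cocycles R A 1,
        α = QuotientAddGroup.mk ⟨_, hc⟩ := by
  classical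
  obtain ⟨⟨a, ha⟩, rfl⟩ := QuotientAddGroup.mk_surjective α
  have ha0 : a ∈ coboundaries R (∅ : Set X) 1 :=
    (mk_eq_zero_iff
      (cochainPullback_mem_cocycles (ContinuousMap.id X) (Set.mapsTo_empty _ _) ha)).1 hα
  obtain ⟨_, ⟨b, -, rfl⟩, v, hv, rfl⟩ := AddSubgroup.mem_sup.1 ha0
  have hb : d 0 b ∈ vanishOn R A 1 := by
    rw [← add_sub_cancel_right (d 0 b) v]
    exact sub_mem (show d 0 b + v ∈ vanishOn R A 1 from ha.1)
      (vanishOn_mono (Set.subset_univ A) 1 hv)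
  obtain ⟨U, hU⟩ := hb
  let β : A → R := fun x => b fun _ => x
  have hβ : IsLocallyConstant β := by
    refine IsLocallyConstant.iff_eventually_eq β |>.2 fun x => ?_
    filter_upwards [((U.isOpen x).preimage continuous_subtype_val).mem_nhds (U.mem x)] with y hy
    have := hU ![(x : X), y] ⟨y, y.2, fun i => by
      fin_cases i
      · exact hy
      · exact U.mem y⟩
    rw [d_zero_apply, sub_eq_zero] at this
    exact this
  have : CompactSpace A := isCompact_iff_compactSpace.1 hA.isCompact
  have hclosed : ∀ T : Set R, IsClosed (Subtype.val '' (β ⁻¹' T)) := fun T =>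
    hA.isClosedEmbedding_subtypeVal.isClosedMap _ ⟨hβ Tᶜ⟩
  have hex : ∀ r : R, ∃ g : C(X, I), (∀ x ∈ Subtype.val '' (β ⁻¹' {r}ᶜ), g x = 0) ∧
      ∀ x ∈ Subtype.val '' (β ⁻¹' {r}), g x = 1 := fun r =>
    exists_unitInterval_map (hclosed _) (hclosed _) <|
      (Set.disjoint_image_iff Subtype.val_injective).2
        ((disjoint_compl_left (a := ({r} : Set R))).preimage β)
  choose g hg0 hg1 using hex
  have hg1' : ∀ x : A, g (β x) x = 1 := fun x => hg1 _ _ ⟨x, rfl, rfl⟩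
  have hg0' : ∀ (x : A) r, β x ≠ r → g r x = 0 := fun x r h => hg0 _ _ ⟨x, h, rfl⟩
  have hg : ∀ r, Set.MapsTo (g r) A {0, 1} := fun r x hx => by
    by_cases h : β ⟨x, hx⟩ = r
    · exact Or.inr (h ▸ hg1' ⟨x, hx⟩)
    · exact Or.inl (hg0' ⟨x, hx⟩ r h)
  refine ⟨hβ.range_finite.toFinset, g, hg, sum_mem fun r _ =>
    smul_mem_cocycles r (pullbackFundamental_mem_cocycles (hg r)), ?_⟩
  rw [mk_eq_mk_iff]
  have hsum : ∑ r ∈ hβ.range_finite.toFinset, r • pullbackFundamental R (g r) =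
      d 0 (∑ r ∈ hβ.range_finite.toFinset, r • cochainPullback (g r) 0 (endCochain R)) := by
    simp only [map_sum, d_smul, pullbackFundamental_eq]
  rw [hsum, add_sub_right_comm, ← map_sub]
  refine add_mem (d_mem_coboundaries (mem_vanishOn_zero hA fun s hs => ?_))
    (vanishOn_univ_le_coboundaries _ _ hv)
  have hbs : b s = β ⟨s 0, hs⟩ := congrArg b
    (funext fun i : Fin 1 => by rw [Subsingleton.elim i 0])
  rw [Pi.sub_apply, hbs, Finset.sum_apply, sub_eq_zero,
    Finset.sum_eq_single_of_mem (β ⟨s 0, hs⟩) (by simp)]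
  · simp [cochainPullback, endCochain, hg1' ⟨s 0, hs⟩]
  · intro r _ hr
    simp [cochainPullback, endCochain, hg0' ⟨s 0, hs⟩ r hr.symm]

/-! ### Expanding a product of linear combinations -/

theorem cochainProd_congr {Y : Type*} {c c' : ℕ → Cochain R Y 1} {n : ℕ}
    (h : ∀ i ≤ n, c i = c' i) : cochainProd c n = cochainProd c' n := by
  induction n with
  | zero => exact h 0 le_rfl
  | succ n ih =>
    rw [cochainProd, cochainProd, ih fun i hi => h i (hi.trans n.le_succ), h (n + 1) le_rfl]

theorem commute_pullbackFundamental (f : C(X, I)) (r : R) (s : Fin 2 → X) :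
    Commute (pullbackFundamental R f s) r := by
  rw [pullbackFundamental_eq, d_zero_apply]
  simp only [cochainPullback, endCochain, AddMonoidHom.coe_mk, ZeroHom.coe_mk]
  refine Commute.sub_left ?_ ?_ <;> split_ifs <;> simp

theorem commute_cochainProd {Y : Type*} {c : ℕ → Cochain R Y 1} {r : R}
    (h : ∀ i s, Commute (c i s) r) (n : ℕ) (s : Fin (n + 2) → Y) :
    Commute (cochainProd c n s) r := by
  induction n with
  | zero => exact h 0 s
  | succ n ih => exact (ih _).mul_left (h _ _)

/-- A product of linear combinations of the integer-valued cocycles `g i r ^* (d e)` is a linear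
combination of their products. Integrality moves the coefficients to the left, so the ring need
not be commutative. -/
theorem cochainProd_sum_mem_span (S : ℕ → Finset R) (g : ℕ → R → C(X, I)) (n : ℕ) :
    cochainProd (fun i => ∑ r ∈ S i, r • pullbackFundamental R (g i r)) n ∈
      Submodule.span R {w | ∃ k : ℕ → R, (∀ i ≤ n, k i ∈ S i) ∧
        w = cochainProd (fun i => pullbackFundamental R (g i (k i))) n} := by
  classical
  induction n with
  | zero =>
    refine Submodule.sum_mem _ fun r hr => Submodule.smul_mem _ r (Submodule.subset_span ?_)
    exact ⟨fun _ => r, fun i hi => by rwa [Nat.le_zero.1 hi], rfl⟩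
  | succ n ih =>
    rw [cochainProd]
    generalize cochainProd (fun i => ∑ r ∈ S i, r • pullbackFundamental R (g i r)) n = w at ih ⊢
    induction ih using Submodule.span_induction with
    | mem u hu =>
      obtain ⟨k, hk, rfl⟩ := hu
      have hdist : cochainCup (cochainProd (fun i => pullbackFundamental R (g i (k i))) n)
          (∑ r ∈ S (n + 1), r • pullbackFundamental R (g (n + 1) r)) =
          ∑ r ∈ S (n + 1), r • cochainCup
            (cochainProd (fun i => pullbackFundamental R (g i (k i))) n)
            (pullbackFundamental R (g (n + 1) r)) := by
        ext s
        simp only [cochainCup, Finset.sum_apply, Pi.smul_apply, smul_eq_mul, Finset.mul_sum]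
        refine Finset.sum_congr rfl fun r _ => ?_
        rw [← mul_assoc, ← mul_assoc, (commute_cochainProd
          (fun i s => commute_pullbackFundamental (g i (k i)) r s) n _).eq]
      rw [hdist]
      refine Submodule.sum_mem _ fun r hr => Submodule.smul_mem _ r (Submodule.subset_span ?_)
      refine ⟨Function.update k (n + 1) r, fun i hi => ?_, ?_⟩
      · rcases eq_or_ne i (n + 1) with rfl | hne
        · simpa using hr
        · rw [Function.update_of_ne hne]
          exact hk i (by omega)
      · rw [cochainProd, Function.update_self]
        congr 1
        refine cochainProd_congr fun i hi => ?_
        rw [Function.update_of_ne (by omega)]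
    | zero =>
      convert Submodule.zero_mem _
      ext s; simp [cochainCup]
    | add u v _ _ hu hv =>
      rw [cochainCup_add_left]
      exact Submodule.add_mem _ hu hv
    | smul r u _ hu =>
      convert Submodule.smul_mem _ r hu using 1
      ext s; simp [cochainCup, mul_assoc]

/-- If a product of linear combinations of the classes `g i r ^* φ` is nonzero in degree `n + 1`,
so is one of the products of these classes. -/
theorem exists_cochainProd_notMem {A : Set X} {S : ℕ → Finset R} {g : ℕ → R → C(X, I)} {n : ℕ}
    (h : cochainProd (fun i => ∑ r ∈ S i, r • pullbackFundamental R (g i r)) n ∉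
      coboundaries R A (n + 1)) :
    ∃ k : ℕ → R, (∀ i ≤ n, k i ∈ S i) ∧
      cochainProd (fun i => pullbackFundamental R (g i (k i))) n ∉ coboundaries R A (n + 1) := by
  by_contra! hk
  refine h ?_
  have hspan := cochainProd_sum_mem_span S g n
  generalize cochainProd (fun i => ∑ r ∈ S i, r • pullbackFundamental R (g i r)) n = w at hspan ⊢
  induction hspan using Submodule.span_induction with
  | mem u hu =>
    obtain ⟨k, hkS, rfl⟩ := hu
    exact hk k hkS
  | zero => exact zero_mem _
  | add u v _ _ hu hv => exact add_mem hu hv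
  | smul r u _ hu => exact smul_mem_coboundaries r hu

/-- König's lemma, as compactness of a product of finite sets: if a condition `P n` on the first
`n + 1` choices grows stronger with `n` and can be met for each `n`, then one sequence of choices
meets all of them. -/
theorem exists_forall_of_finite_choices {ι : Type*} (S : ℕ → Finset ι) (P : ℕ → (ℕ → ι) → Prop)
    (hcongr : ∀ n k k', (∀ i ≤ n, k i = k' i) → P n k → P n k')
    (hanti : ∀ n k, P (n + 1) k → P n k)
    (hex : ∀ n, ∃ k, (∀ i ≤ n, k i ∈ S i) ∧ P n k) :
    ∃ k, ∀ n, k n ∈ S n ∧ P n k := by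
  let _ : TopologicalSpace ι := ⊥
  have : DiscreteTopology ι := ⟨rfl⟩
  have hS : ∀ n, (S n).Nonempty := fun n =>
    let ⟨k, hk, _⟩ := hex n
    ⟨k n, hk n le_rfl⟩
  have hK : IsCompact (Set.univ.pi fun i => (S i : Set ι)) :=
    isCompact_univ_pi fun i => (S i).finite_toSet.isCompact
  have hP : ∀ n, IsClosed {k | P n k} := fun n => by
    rw [← isOpen_compl_iff, isOpen_iff_mem_nhds]
    intro k hk
    have hev : ∀ᶠ k' in nhds k, ∀ i ∈ Finset.range (n + 1), k' i = k i :=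
      (Filter.eventually_all_finset _).2 fun i _ =>
        (continuous_apply i).continuousAt.eventually
          ((isOpen_discrete ({k i} : Set ι)).mem_nhds rfl)
    filter_upwards [hev] with k' hk' hPk'
    exact hk (hcongr n k' k (fun i hi => hk' i (Finset.mem_range.2 (by omega))) hPk')
  have hcl : ∀ n, IsClosed ((Set.univ.pi fun i => (S i : Set ι)) ∩ {k | P n k}) := fun n =>
    hK.isClosed.inter (hP n)
  have hne : ∀ n, ((Set.univ.pi fun i => (S i : Set ι)) ∩ {k | P n k}).Nonempty := fun n => by
    obtain ⟨k, hkS, hPk⟩ := hex n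
    refine ⟨fun i => if i ≤ n then k i else (hS i).choose, fun i _ => ?_,
      hcongr n k _ (fun i hi => by simp [hi]) hPk⟩
    by_cases hi : i ≤ n
    · simpa [hi] using hkS i hi
    · simpa [hi] using (hS i).choose_spec
  obtain ⟨k, hk⟩ := IsCompact.nonempty_iInter_of_sequence_nonempty_isCompact_isClosed
    (fun n => (Set.univ.pi fun i => (S i : Set ι)) ∩ {k | P n k})
    (fun n k hk => ⟨hk.1, hanti n k hk.2⟩) hne (hK.inter_right (hP 0)) hcl
  have hk := Set.mem_iInter.1 hk
  exact ⟨k, fun n => ⟨(hk 0).1 n trivial, (hk n).2⟩⟩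

end Cech

theorem proposition2p1 {X : Type*} [MetricSpace X] [CompactSpace X] {R : Type*} [Ring R]
    (A : ℕ → Set X) (hA : ∀ i, IsClosed (A i)) (α : ∀ i, Cech.H R (A i) 1)
    (hpure : ∀ i, Cech.IsPureRelative (α i)) (hcup : ∀ n, Cech.cupProd α n ≠ 0) :
    StronglyInfiniteDimensional X ∧
      ∀ (f : ℕ → C(X, I)) (hf : ∀ i, Set.MapsTo (f i) (A i) {0, 1}),
        (∀ i, Cech.pullback (f i) (hf i) 1 (Cech.fundamentalClass R) = α i) →
          IsEssentialHilbert (ContinuousMap.pi f) := by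
  constructor
  · choose S g hg hc hα using fun i => (hpure i).exists_eq_sum (hA i)
    obtain rfl : α = fun i => QuotientAddGroup.mk ⟨_, hc i⟩ := funext hα
    obtain ⟨k, hk⟩ := Cech.exists_forall_of_finite_choices S
      (fun n k => Cech.cochainProd (fun i => Cech.pullbackFundamental R (g i (k i))) n ∉
        Cech.coboundaries R (Cech.unionUpTo A n) (n + 1))
      (fun n k k' h hk => by
        rwa [← Cech.cochainProd_congr (c := fun i => Cech.pullbackFundamental R (g i (k i)))
          fun i hi => by rw [h i hi]])
      (fun n k hk h => hk (Cech.cochainCup_mem_coboundaries_left h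
        (Cech.pullbackFundamental_mem_cocycles (hg (n + 1) (k (n + 1))))))
      (fun n => Cech.exists_cochainProd_notMem fun h => hcup n <|
        (Cech.cupProd_mk hc n).trans ((Cech.mk_eq_zero_iff _).2 h))
    have hne : ∀ n, Cech.cupProd (fun i => Cech.pullback (g i (k i)) (hg i (k i)) 1
        (Cech.fundamentalClass R)) n ≠ 0 := fun n h => (hk n).2 <| (Cech.mk_eq_zero_iff _).1 <|
      (Cech.cupProd_mk
        (fun i => Cech.pullbackFundamental_mem_cocycles (hg i (k i))) n).symm.trans h
    exact ⟨_, Cech.surjective_pi_of_cupProd_ne_zero hA _ hne,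
      Cech.isEssentialHilbert_of_cupProd_ne_zero hA _ hne⟩
  · intro f hf hα
    obtain rfl : (fun i => Cech.pullback (f i) (hf i) 1 (Cech.fundamentalClass R)) = α := funext hα
    exact Cech.isEssentialHilbert_of_cupProd_ne_zero hA hf hcup
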